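/- For a finite simple graph $G$, let $d(G)$ (respectively $d_t(G)$) be the largest integer $m$ for which the vertices of $G$ can be coloured with $m$ colours so that every vertex $v$ has vertices of all $m$ colours in its closed neighbourhood $N[v]$ (respectively in its open neighbourhood $N(v)$). For integers $n\ge 1$, $q\ge 2$, let $H_{n,q}$ be the Hamming graph, i.e. the Cartesian product of $n$ copies of the complete graph $K_q$. Let $n$ be a positive integer and $q$ a prime power (of positive exponent). Let $k$ be the largest positive integer such that $\frac{q^k-1}{q-1}\le n$, let $j$ be the smallest positive integer such that $q^k\le 2^j\lfloor q/2\rfloor$, and let $i$ be the largest non-negative integer such that $\frac{q^k-1}{q-1}+(2^i-1)2^j\le n$. Then $$d(H_{n,q})\ge 2^i q^k\qquad\text{and}\qquad d_t(H_{n+1,q})\ge 2^i q^k .$$ -/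

import Mathlib

/-- A domatic `k`-coloring: a map from the vertices to `k` colors such that every vertex sees
all `k` colors in its closed neighborhood. -/
def IsDomaticColoring {V : Type*} (G : SimpleGraph V) (k : ℕ) (f : V → Fin k) : Prop :=
  ∀ (v : V) (c : Fin k), ∃ u : V, (u = v ∨ G.Adj v u) ∧ f u = c

/-- A total domatic `k`-coloring: every vertex sees all `k` colors in its open neighborhood. -/
def IsTotalDomaticColoring {V : Type*} (G : SimpleGraph V) (k : ℕ) (f : V → Fin k) : Prop :=
  ∀ (v : V) (c : Fin k), ∃ u : V, G.Adj v u ∧ f u = c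

/-- The domatic number `d(G)`: the maximum `k` for which `G` has a domatic `k`-coloring.
For a finite nonempty graph the maximum exists, see `isGreatest_domaticNumber`. -/
noncomputable def domaticNumber {V : Type*} (G : SimpleGraph V) : ℕ :=
  sSup {k : ℕ | ∃ f : V → Fin k, IsDomaticColoring G k f}

/-- The total domatic number `d_t(G)`: the maximum `k` for which `G` has a total domatic
`k`-coloring. For a finite nonempty graph without isolated vertices the maximum exists, see
`isGreatest_totalDomaticNumber`. -/
noncomputable def totalDomaticNumber {V : Type*} (G : SimpleGraph V) : ℕ :=
  sSup {k : ℕ | ∃ f : V → Fin k, IsTotalDomaticColoring G k f}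

/-- The Cartesian product of a family of graphs: two vertices are adjacent iff they are adjacent
in one coordinate and agree in all the others. -/
def cartesianProduct {ι : Type*} {V : ι → Type*} (G : ∀ i, SimpleGraph (V i)) :
    SimpleGraph (∀ i, V i) where
  Adj x y := ∃ i, (G i).Adj (x i) (y i) ∧ ∀ j, j ≠ i → x j = y j
  symm := ⟨fun _ _ ⟨i, h, h'⟩ => ⟨i, h.symm, fun j hj => (h' j hj).symm⟩⟩
  loopless := ⟨fun _ ⟨i, h, _⟩ => (G i).irrefl h⟩

/-- The Hamming graph `H_{n,q}`: the Cartesian product of `n` copies of the complete graph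
`K_q`. -/
def hammingGraph (n q : ℕ) : SimpleGraph (Fin n → Fin q) :=
  cartesianProduct fun _ : Fin n => (⊤ : SimpleGraph (Fin q))

theorem bddAbove_domaticColoring {V : Type*} [Finite V] [Nonempty V] (G : SimpleGraph V) :
    BddAbove {k : ℕ | ∃ f : V → Fin k, IsDomaticColoring G k f} := by
  refine ⟨Nat.card V, ?_⟩
  rintro k ⟨f, hf⟩
  have hs : Function.Surjective f := fun c =>
    let ⟨u, _, hu⟩ := hf (Classical.arbitrary V) c
    ⟨u, hu⟩
  simpa using Nat.card_le_card_of_surjective f hs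

theorem isGreatest_domaticNumber {V : Type*} [Finite V] [Nonempty V] (G : SimpleGraph V) :
    IsGreatest {k : ℕ | ∃ f : V → Fin k, IsDomaticColoring G k f} (domaticNumber G) := by
  have hb := bddAbove_domaticColoring G
  exact ⟨Nat.sSup_mem ⟨1, fun _ => 0, fun v c => ⟨v, Or.inl rfl, Subsingleton.elim _ _⟩⟩ hb,
    fun k hk => le_csSup hb hk⟩

theorem isGreatest_totalDomaticNumber {V : Type*} [Finite V] [Nonempty V] (G : SimpleGraph V)
    (hG : ∀ v, ∃ u, G.Adj v u) :
    IsGreatest {k : ℕ | ∃ f : V → Fin k, IsTotalDomaticColoring G k f}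
      (totalDomaticNumber G) := by
  have hb : BddAbove {k : ℕ | ∃ f : V → Fin k, IsTotalDomaticColoring G k f} := by
    refine (bddAbove_domaticColoring G).mono ?_
    rintro k ⟨f, hf⟩
    exact ⟨f, fun v c => (hf v c).imp fun u hu => ⟨Or.inr hu.1, hu.2⟩⟩
  refine ⟨Nat.sSup_mem ⟨1, fun _ => 0, fun v c => ?_⟩ hb, fun k hk => le_csSup hb hk⟩
  obtain ⟨u, hu⟩ := hG v
  exact ⟨u, hu, Subsingleton.elim _ _⟩

/-! Colour words by W × 𝔽₂^i, where W = F^k and |F| = q. The letters are indexed by the points of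
ℙ(W) and by a block of 2^j positions for each nonzero b in 𝔽₂^i. The W-part adds the Hamming
syndrome to the block colours; the 𝔽₂^i-part adds those b whose block has odd parity. To reach a
colour, let d be the required change of the 𝔽₂^i-part. If d = 0, one Hamming letter corrects the
W-part. Otherwise one letter of block d flips its parity and gives the block any colour in W
(`exists_parity_coloring`). -/

open scoped LinearAlgebra.Projectivization

/-- A coloring of words over `α` indexed by `ι` such that every word can be given any prescribed
color by changing at most one of its letters. -/
def IsSingleChangeColoring {ι α C : Type*} [DecidableEq ι] (f : (ι → α) → C) : Prop :=
  ∀ (v : ι → α) (c : C), ∃ t a, f (Function.update v t a) = c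

theorem sum_apply_update {ι α A : Type*} [Fintype ι] [DecidableEq ι] [AddCommGroup A]
    (φ : ι → α → A) (x : ι → α) (t : ι) (a : α) :
    ∑ s, φ s (Function.update x t a s) = ∑ s, φ s (x s) + (φ t a - φ t (x t)) := by
  rw [← sub_eq_iff_eq_add', ← Finset.sum_sub_distrib, Finset.sum_eq_single t]
  · simp
  · intro s _ hs
    simp [Function.update_of_ne hs]
  · simp

/-- Every vector is reached by changing one coefficient of a linear combination that involves one
representative of each line: the Hamming code. -/
theorem exists_smul_rep_eq {F W : Type*} [Field F] [AddCommGroup W] [Module F W] [Nontrivial W]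
    (w : W) : ∃ (p : ℙ F W) (a : F), a • p.rep = w := by
  by_cases hw : w = 0
  · obtain ⟨u, hu⟩ := exists_ne (0 : W)
    exact ⟨Projectivization.mk F u hu, 0, by simp [hw]⟩
  · obtain ⟨a, ha⟩ := Projectivization.exists_smul_eq_mk_rep F w hw
    exact ⟨Projectivization.mk F w hw, ((a⁻¹ : Fˣ) : F), by
      rw [← ha, ← Units.smul_def, inv_smul_smul]⟩

/-- An alphabet with `q` letters contains two disjoint classes of `q / 2` letters each. -/
theorem exists_class_index (q : ℕ) (hq : 2 ≤ q) :
    ∃ (cls : Fin q → ZMod 2) (idx : Fin q → ZMod (q / 2)),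
      ∀ e r, ∃ a, cls a = e ∧ idx a = r := by
  have hm : 0 < q / 2 := by omega
  have : NeZero (q / 2) := ⟨hm.ne'⟩
  -- Quotient and remainder by q / 2; for odd q the last letter is superfluous.
  refine ⟨fun a => ((a.val / (q / 2) : ℕ) : ZMod 2), fun a => (a.val : ZMod (q / 2)),
    fun e r => ?_⟩
  have he : e.val < 2 := ZMod.val_lt e
  have hr : r.val < q / 2 := ZMod.val_lt r
  have hlt : r.val + q / 2 * e.val < q := by
    have : q / 2 * e.val ≤ q / 2 * 1 := Nat.mul_le_mul_left _ (by omega)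
    omega
  refine ⟨⟨r.val + q / 2 * e.val, hlt⟩, ?_, ?_⟩
  · simp [Nat.add_mul_div_left _ _ hm, Nat.div_eq_of_lt hr]
  · simp

/-- A coloring of words of length `2 ^ j` in which every color is reached by changing one letter
in such a way that the parity flips. -/
theorem exists_parity_coloring {S : Type*} [Finite S] [Nonempty S] (j q : ℕ) (hq : 2 ≤ q)
    (hS : Nat.card S ≤ 2 ^ j * (q / 2)) :
    ∃ (h : ((Fin j → ZMod 2) → Fin q) → S) (p : ((Fin j → ZMod 2) → Fin q) → ZMod 2),
      ∀ x s, ∃ t a, h (Function.update x t a) = s ∧ p (Function.update x t a) = p x + 1 := by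
  obtain ⟨cls, idx, hci⟩ := exists_class_index q hq
  have : NeZero (q / 2) := ⟨by omega⟩
  obtain ⟨g, hg⟩ : ∃ g : (Fin j → ZMod 2) × ZMod (q / 2) → S, Function.Surjective g := by
    cases nonempty_fintype S
    obtain ⟨e⟩ : Nonempty (S ↪ (Fin j → ZMod 2) × ZMod (q / 2)) := by
      refine Function.Embedding.nonempty_of_card_le ?_
      rw [← Nat.card_eq_fintype_card]
      simpa using hS
    exact ⟨Function.invFun e, Function.invFun_surjective e.injective⟩
  refine ⟨fun x => g (∑ t, cls (x t) • t, ∑ t, idx (x t)), fun x => ∑ t, cls (x t),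
    fun x s => ?_⟩
  obtain ⟨⟨c, r⟩, rfl⟩ := hg s
  -- Flipping the class at position t shifts the weighted sum by exactly t, so t must be the
  -- required shift; t = 0 is allowed. The index of the new letter stays free to correct the other
  -- sum.
  let t := c - ∑ t, cls (x t) • t
  obtain ⟨a, ha, har⟩ := hci (cls (x t) + 1) (r - ∑ t, idx (x t) + idx (x t))
  refine ⟨t, a, ?_, ?_⟩
  · have h₁ := sum_apply_update (fun s b => cls b • s) x t a
    have h₂ := sum_apply_update (fun _ b => idx b) x t a
    simp only at h₁ h₂ ⊢
    rw [h₁, h₂, ← sub_smul, ha, har]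
    simp [t]
  · have h₁ := sum_apply_update (fun _ b => cls b) x t a
    simp only at h₁ ⊢
    rw [h₁, ha]
    simp

/-- The coloring by `F ^ k × 𝔽₂ ^ i` that combines a Hamming code with one block of letters for
each nonzero vector of `𝔽₂ ^ i`. -/
theorem exists_isSingleChangeColoring {F W : Type} [Field F] [Finite F] [AddCommGroup W]
    [Module F W] [Nontrivial W] [Finite W] (i j q : ℕ) (hq : 2 ≤ q) (hF : Nat.card F = q)
    (hW : Nat.card W ≤ 2 ^ j * (q / 2))
    [DecidableEq (ℙ F W ⊕ {a : Fin i → ZMod 2 // a ≠ 0} × (Fin j → ZMod 2))] :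
    ∃ f : (ℙ F W ⊕ {a : Fin i → ZMod 2 // a ≠ 0} × (Fin j → ZMod 2) → Fin q) →
      W × (Fin i → ZMod 2), IsSingleChangeColoring f := by
  classical
  obtain ⟨h, p, hp⟩ := exists_parity_coloring (S := W) j q hq hW
  let e : Fin q ≃ F := (finCongr hF.symm).trans (Finite.equivFin F).symm
  cases nonempty_fintype (ℙ F W)
  refine ⟨fun v => (∑ l, e (v (.inl l)) • l.rep + ∑ b, h (fun t => v (.inr (b, t))),
    ∑ b, p (fun t => v (.inr (b, t))) • b.1), ?_⟩
  rintro v ⟨w, c⟩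
  have hl (l a) : (fun m => Function.update v (.inl l) a (.inl m)) =
      Function.update (fun m => v (.inl m)) l a := by
    ext m; simp [Function.update_apply]
  have hb (b t a) : (fun b' t' => Function.update v (.inr (b, t)) a (.inr (b', t'))) =
      Function.update (fun b' t' => v (.inr (b', t'))) b
        (Function.update (fun t' => v (.inr (b, t'))) t a) := by
    ext b' t'
    by_cases hbb : b' = b
    · subst hbb; simp [Function.update_apply]
    · simp [hbb]
  by_cases hc : c = ∑ b, p (fun t => v (.inr (b, t))) • b.1
  · obtain ⟨l, a, hla⟩ := exists_smul_rep_eq (F := F)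
      (w - (∑ l, e (v (.inl l)) • l.rep + ∑ b, h (fun t => v (.inr (b, t)))))
    refine ⟨.inl l, e.symm (a + e (v (.inl l))), Prod.ext ?_ ?_⟩
    · have h₁ := sum_apply_update (fun (l : ℙ F W) x => e x • l.rep) (fun m => v (.inl m)) l
        (e.symm (a + e (v (.inl l))))
      rw [← hl] at h₁
      simp only [Equiv.apply_symm_apply, add_smul, add_sub_cancel_right, hla] at h₁
      simp only [h₁]
      simp
      abel
    · simp [hc]
  · let b : {a : Fin i → ZMod 2 // a ≠ 0} :=
      ⟨c - ∑ b, p (fun t => v (.inr (b, t))) • b.1, sub_ne_zero.2 hc⟩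
    -- The old colour of block b is added back because the new one replaces it.
    obtain ⟨t, a, hta, hpa⟩ := hp (fun t => v (.inr (b, t)))
      (w - (∑ l, e (v (.inl l)) • l.rep + ∑ b, h (fun t => v (.inr (b, t)))) +
        h (fun t => v (.inr (b, t))))
    refine ⟨.inr (b, t), a, Prod.ext ?_ ?_⟩
    · have h₁ := sum_apply_update (fun _ x => h x) (fun b' t' => v (.inr (b', t'))) b
        (Function.update (fun t' => v (.inr (b, t'))) t a)
      rw [← hb] at h₁
      simp only [hta] at h₁
      simp only [h₁]
      simp
      abel
    · have h₁ := sum_apply_update (fun b x => p x • b.1) (fun b' t' => v (.inr (b', t'))) b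
        (Function.update (fun t' => v (.inr (b, t'))) t a)
      rw [← hb] at h₁
      simp only [hpa] at h₁
      simp only [h₁, ← sub_smul]
      simp [b]

theorem hammingGraph_adj_update {n q : ℕ} (v : Fin n → Fin q) (t : Fin n) (a : Fin q)
    (ha : v t ≠ a) : (hammingGraph n q).Adj v (Function.update v t a) :=
  ⟨t, by simpa using ha, fun s hs => by simp [hs]⟩

/-- Coordinates outside the range of `e` are ignored, so n may exceed the code length. -/
theorem isDomaticColoring_hammingGraph {ι : Type*} [DecidableEq ι] {n q m : ℕ}
    {f : (ι → Fin q) → Fin m} (hf : IsSingleChangeColoring f) (e : ι ↪ Fin n) :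
    IsDomaticColoring (hammingGraph n q) m (fun v => f (v ∘ e)) := by
  intro v c
  obtain ⟨t, a, hta⟩ := hf (v ∘ e) c
  refine ⟨Function.update v (e t) a, ?_, ?_⟩
  · by_cases h : v (e t) = a
    · exact .inl (by simp [← h])
    · exact .inr (hammingGraph_adj_update v _ a h)
  · simpa only [Function.update_comp_eq_of_injective v e.injective] using hta

/-- When a vertex itself carries the wanted colour, a move in the ignored last coordinate gives a
neighbour of that colour. -/
theorem isTotalDomaticColoring_hammingGraph_succ {n q m : ℕ} (hq : 2 ≤ q)
    {f : (Fin n → Fin q) → Fin m} (hf : IsDomaticColoring (hammingGraph n q) m f) :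
    IsTotalDomaticColoring (hammingGraph (n + 1) q) m (fun v => f (Fin.init v)) := by
  intro v c
  obtain ⟨u, rfl | ⟨t, ht, hu⟩, huc⟩ := hf (Fin.init v) c
  · have : Nontrivial (Fin q) := Fin.nontrivial_iff_two_le.2 hq
    obtain ⟨a, ha⟩ := exists_ne (v (Fin.last n))
    refine ⟨Function.update v (Fin.last n) a, hammingGraph_adj_update v _ a ha.symm, ?_⟩
    simpa [Fin.init_update_last] using huc
  · refine ⟨Fin.snoc u (v (Fin.last n)), ⟨t.castSucc, ?_, fun s hs => ?_⟩, by simpa using huc⟩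
    · simpa [Fin.init] using ht
    · induction s using Fin.lastCases with
      | last => simp
      | cast s => simpa [Fin.init] using hu s (fun h => hs (by rw [h]))

theorem corollary4p7 (n q k j i : ℕ) (hn : 0 < n) (hq : IsPrimePow q)
    (hk : IsGreatest {m : ℕ | 0 < m ∧ (q ^ m - 1) / (q - 1) ≤ n} k)
    (hj : IsLeast {m : ℕ | 0 < m ∧ q ^ k ≤ 2 ^ m * (q / 2)} j)
    (hi : IsGreatest {m : ℕ | (q ^ k - 1) / (q - 1) + (2 ^ m - 1) * 2 ^ j ≤ n} i) :
    2 ^ i * q ^ k ≤ domaticNumber (hammingGraph n q) ∧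
      2 ^ i * q ^ k ≤ totalDomaticNumber (hammingGraph (n + 1) q) := by
  classical
  have hq2 : 2 ≤ q := hq.two_le
  have : Nontrivial (Fin q) := Fin.nontrivial_iff_two_le.2 hq2
  have : NeZero k := ⟨hk.1.1.ne'⟩
  obtain ⟨r, s, hr, hs, rfl⟩ := hq
  have : Fact r.Prime := ⟨hr.nat_prime⟩
  let F := GaloisField r s
  have hF : Nat.card F = r ^ s := GaloisField.card r s hs.ne'
  have hW : Nat.card (Fin k → F) = (r ^ s) ^ k := by rw [Nat.card_fun, hF, Nat.card_fin]
  obtain ⟨f₀, hf₀⟩ := exists_isSingleChangeColoring (F := F) (W := Fin k → F) i j _ hq2 hF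
    (hW.trans_le hj.1.2)
  let E : (Fin k → F) × (Fin i → ZMod 2) ≃ Fin (2 ^ i * (r ^ s) ^ k) :=
    Finite.equivFinOfCardEq (by simp [Nat.card_prod, hW, mul_comm])
  have hf : IsSingleChangeColoring (fun v => E (f₀ v)) := fun v c => by
    obtain ⟨t, a, h⟩ := hf₀ v (E.symm c)
    exact ⟨t, a, by simp [h]⟩
  have hP : Nat.card (ℙ F (Fin k → F)) = ((r ^ s) ^ k - 1) / (r ^ s - 1) := by
    rw [Projectivization.card'', hW, hF]
  have hB : Nat.card {a : Fin i → ZMod 2 // a ≠ 0} = 2 ^ i - 1 := by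
    simp
  obtain ⟨e⟩ : Nonempty (ℙ F (Fin k → F) ⊕ {a : Fin i → ZMod 2 // a ≠ 0} ×
      (Fin j → ZMod 2) ↪ Fin n) := by
    cases nonempty_fintype (ℙ F (Fin k → F))
    refine Function.Embedding.nonempty_of_card_le ?_
    rw [← Nat.card_eq_fintype_card, Nat.card_sum, Nat.card_prod, hP, hB]
    simpa using hi.1
  have hd := isDomaticColoring_hammingGraph hf e
  exact ⟨(isGreatest_domaticNumber _).2 ⟨_, hd⟩, (isGreatest_totalDomaticNumber _ fun v =>
    let ⟨a, ha⟩ := exists_ne (v 0)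
    ⟨_, hammingGraph_adj_update v 0 a ha.symm⟩).2
      ⟨_, isTotalDomaticColoring_hammingGraph_succ hq2 hd⟩⟩
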